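/- Let $A$ and $B$ be unital complex Banach algebras (complete, with submultiplicative norm and $\|e_A\|=\|e_B\|=1$). Suppose that $A$ is commutative and that $B$ is semisimple, i.e. its Jacobson radical is zero. Let $\mathfrak{A}$ be an open subgroup of the group $A^{-1}$ of invertible elements of $A$, and $\mathfrak{B}$ an open subgroup of the group $B^{-1}$ of invertible elements of $B$, all these groups being equipped with the metric induced by the norm. Suppose that $T:\mathfrak{A}\to\mathfrak{B}$ is a surjective isometry of metric spaces, i.e. $\|T(a)-T(b)\|=\|a-b\|$ for all $a,b\in\mathfrak{A}$ and $T(\mathfrak{A})=\mathfrak{B}$. Then the map $(T(e_A))^{-1}T$ extends to an isometric real-algebra isomorphism from $A$ onto $B$: there is a bijective, isometric, real-linear and multiplicative map $\Phi:A\to B$ with $\Phi(a)=(T(e_A))^{-1}T(a)$ for every $a\in\mathfrak{A}$. Moreover, $A$ is semisimple and $B$ is commutative. In particular, $A^{-1}$ and $B^{-1}$ are isometrically isomorphic as metrizable groups, i.e. there is a group isomorphism from $A^{-1}$ onto $B^{-1}$ that preserves the norm distance. -/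

import Mathlib

/-- A ring is semisimple in the sense of Banach algebra theory (also called Jacobson semisimple, or
semiprimitive) if its Jacobson radical, the intersection of its maximal left ideals, is zero. This
is weaker than Mathlib's `IsSemisimpleRing`, which includes the Artinian condition. -/
def JacobsonSemisimple (R : Type*) [Ring R] : Prop :=
  Ring.jacobson R = ⊥

/-!
A surjective isometry between open subsets of real normed spaces preserves the midpoints of short
segments, by Väisälä's reflection argument for the Mazur–Ulam theorem, and so is affine on connected
subsets. The complex cone generated by the unit ball around `1` is connected and lies in every open
group of units, so `T` agrees on it with `L + v` for a real-linear isometry `L`. For `a` in the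
group, `T a = L c + v` where `c` has the same distance as `a` to all points of the cone; comparing
distances to large scalars gives `‖1 + w (a - c)‖ ≤ 1` for small `w`, and Cauchy's estimate for the
powers of `1 + w (a - c)` forces `c = a`. Translation by `2 v` maps the second group into itself, so
`v = 0` by semisimplicity.

Let `χ` be a character of `A` and `u = L 1`. The real-linear functional `f b = χ (L⁻¹ (u b))` has no
zeros on exponentials. Writing `f = φ + conj ψ` with `φ` and `ψ` complex-linear, one of `φ`, `ψ`
dominates the other on all exponentials, Liouville's theorem makes them proportional, and the
Gleason–Kahane–Żelazko theorem shows that `f` factors through a character of `B`. As `L` is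
isometric, the remaining real-linear map `ℂ → ℂ` is the identity or the conjugation, so `f` is
multiplicative. Hence `u⁻¹ L` is multiplicative up to elements whose preimage is killed by all
characters of `A`, and such elements lie in the Jacobson radical of `B`.
-/

open Set Metric Filter Topology

/-- The function `f` restricts to a surjective isometry from `U` onto `V`; its values off `U` are
irrelevant. -/
structure IsometryOnto {X Y : Type*} [PseudoMetricSpace X] [PseudoMetricSpace Y] (f : X → Y)
    (U : Set X) (V : Set Y) : Prop where
  dist_eq : ∀ x ∈ U, ∀ y ∈ U, dist (f x) (f y) = dist x y
  image_eq : f '' U = V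

/-- `R` is an isometry which interchanges `x` and `y` and moves every point by twice its distance to
`z`. This abstracts the reflection in the midpoint `z` of a segment `[x, y]`, so that Väisälä's
proof of the Mazur–Ulam theorem applies in metric spaces without a linear structure, such as a
symmetric neighbourhood of the segment. -/
structure IsMidpointReflection {X : Type*} [PseudoMetricSpace X] (R : X ≃ᵢ X) (x y z : X) :
    Prop where
  map_left : R x = y
  map_right : R y = x
  dist_map_self : ∀ w, dist (R w) w = 2 * dist w z

namespace IsMidpointReflection

variable {X Y : Type*} [MetricSpace X] [MetricSpace Y] {R : X ≃ᵢ X} {S : Y ≃ᵢ Y} {x y z : X}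
  {x' y' z' : Y}

theorem map_center (hR : IsMidpointReflection R x y z) : R z = z :=
  dist_le_zero.1 (by simp [hR.dist_map_self])

theorem eq_center (hR : IsMidpointReflection R x y z) {w : X} (hw : R w = w) : w = z := by
  have := hR.dist_map_self w
  rw [hw, dist_self] at this
  exact dist_le_zero.1 (by linarith)

theorem center_fixed (hR : IsMidpointReflection R x y z) {e : X ≃ᵢ X} (hx : e x = x)
    (hy : e y = y) : e z = z := by
  set s := {e : X ≃ᵢ X | e x = x ∧ e y = y}
  have : Nonempty s := ⟨⟨.refl X, rfl, rfl⟩⟩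
  have h_bdd : BddAbove (range fun e : s ↦ dist ((e : X ≃ᵢ X) z) z) := by
    refine ⟨dist x z + dist x z, forall_mem_range.2 <| Subtype.forall.2 fun e he ↦ ?_⟩
    calc dist (e z) z ≤ dist (e z) x + dist x z := dist_triangle ..
      _ = dist x z + dist x z := by rw [dist_comm, ← e.dist_eq x z, he.1]
  let commutator (e : X ≃ᵢ X) : X ≃ᵢ X := ((e.trans R).trans e.symm).trans R
  have h_double (e : X ≃ᵢ X) : dist (commutator e z) z = 2 * dist (e z) z := by
    calc dist (commutator e z) z = dist (R (e.symm (R (e z)))) (R z) := by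
          rw [hR.map_center]; rfl
      _ = dist (R (e z)) (e z) := by rw [R.dist_eq, ← e.dist_eq, e.apply_symm_apply]
      _ = 2 * dist (e z) z := hR.dist_map_self _
  have h_mapsTo : MapsTo commutator s s := by
    rintro e ⟨hx, hy⟩
    constructor <;>
      simp [commutator, hx, hy, e.symm_apply_eq.2 hx.symm, e.symm_apply_eq.2 hy.symm,
        hR.map_left, hR.map_right]
  set c := ⨆ e : s, dist ((e : X ≃ᵢ X) z) z
  have h_half : c ≤ c / 2 := by
    refine ciSup_le fun ⟨e, he⟩ ↦ ?_
    rw [le_div_iff₀' two_pos, ← h_double]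
    exact le_ciSup h_bdd ⟨commutator e, h_mapsTo he⟩
  have h_le : dist (e z) z ≤ c := le_ciSup h_bdd ⟨e, hx, hy⟩
  exact dist_le_zero.1 (by linarith)

theorem map_center_eq (hR : IsMidpointReflection R x y z) (hS : IsMidpointReflection S x' y' z')
    {e : X ≃ᵢ Y} (hx : e x = x') (hy : e y = y') : e z = z' := by
  have h : R (e.symm (S (e z))) = z :=
    hR.center_fixed (e := ((e.trans S).trans e.symm).trans R)
      (by simp [hx, hS.map_left, ← hy, hR.map_right])
      (by simp [hy, hS.map_right, ← hx, hR.map_left])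
  have h' : e.symm (S (e z)) = z := R.injective (h.trans hR.map_center.symm)
  exact hS.eq_center (e.symm_apply_eq.1 h')

end IsMidpointReflection

namespace IsometryOnto

section Metric

variable {X Y : Type*} [MetricSpace X] [MetricSpace Y] {f : X → Y} {U : Set X} {V : Set Y}

theorem injOn (hf : IsometryOnto f U V) : InjOn f U := fun x hx y hy hxy ↦
  dist_eq_zero.1 (by rw [← hf.dist_eq x hx y hy, hxy, dist_self])

theorem mapsTo (hf : IsometryOnto f U V) : MapsTo f U V := fun _ hx ↦
  hf.image_eq ▸ mem_image_of_mem f hx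

theorem inter_ball (hf : IsometryOnto f U V) {x : X} (hx : x ∈ U) (ρ : ℝ) :
    IsometryOnto f (U ∩ ball x ρ) (V ∩ ball (f x) ρ) where
  dist_eq y hy z hz := hf.dist_eq y hy.1 z hz.1
  image_eq := by
    rw [← hf.image_eq]
    ext w
    constructor
    · rintro ⟨y, ⟨hy, hyx⟩, rfl⟩
      exact ⟨⟨y, hy, rfl⟩, by rwa [mem_ball, hf.dist_eq y hy x hx]⟩
    · rintro ⟨⟨y, hy, rfl⟩, hyx⟩
      exact ⟨y, ⟨hy, by rwa [mem_ball, ← hf.dist_eq y hy x hx]⟩, rfl⟩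

theorem exists_isometryEquiv (hf : IsometryOnto f U V) :
    ∃ e : U ≃ᵢ V, ∀ x : U, (e x : Y) = f x := by
  have hbij : BijOn f U V := ⟨hf.mapsTo, hf.injOn, hf.image_eq.ge⟩
  exact ⟨⟨hbij.equiv f, Isometry.of_dist_eq fun x y ↦ hf.dist_eq x x.2 y y.2⟩, fun _ ↦ rfl⟩

theorem continuousOn (hf : IsometryOnto f U V) : ContinuousOn f U :=
  continuousOn_iff_continuous_domRestrict.2
    (Isometry.of_dist_eq fun x y : U ↦ hf.dist_eq x x.2 y y.2).continuous

theorem inter_balls (hf : IsometryOnto f U V) {x y : X} {ρ : ℝ} (hU : ball x ρ ⊆ U)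
    (hV : ball (f x) ρ ⊆ V) (hxy : dist x y < ρ) :
    IsometryOnto f (ball x ρ ∩ ball y ρ) (ball (f x) ρ ∩ ball (f y) ρ) := by
  have hx : x ∈ U := hU (mem_ball_self (dist_nonneg.trans_lt hxy))
  have h := hf.inter_ball hx ρ
  rw [inter_eq_right.2 hU, inter_eq_right.2 hV] at h
  exact h.inter_ball (mem_ball'.2 hxy) ρ

end Metric

section Normed

variable {E F : Type*} [NormedAddCommGroup E] [NormedSpace ℝ E] [NormedAddCommGroup F]
  [NormedSpace ℝ F] {f : E → F} {U : Set E} {V : Set F}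

theorem pointReflection_midpoint (x y : E) (ρ : ℝ) :
    IsometryOnto (AffineIsometryEquiv.pointReflection ℝ (midpoint ℝ x y))
      (ball x ρ ∩ ball y ρ) (ball x ρ ∩ ball y ρ) where
  dist_eq _ _ _ _ := AffineIsometryEquiv.dist_map ..
  image_eq := by
    set P := AffineIsometryEquiv.pointReflection ℝ (midpoint ℝ x y)
    have hPx : P x = y := by simp [P]
    have hPy : P y = x := by simp [P]
    have himage (a : E) : P '' ball a ρ = ball (P a) ρ := P.toIsometryEquiv.image_ball a ρ
    rw [image_inter P.injective, himage, himage, hPx, hPy, inter_comm]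

theorem exists_isMidpointReflection {x y : E} {ρ : ℝ} (hxy : dist x y < ρ) :
    ∃ (R : (ball x ρ ∩ ball y ρ : Set E) ≃ᵢ (ball x ρ ∩ ball y ρ : Set E))
      (hx : x ∈ ball x ρ ∩ ball y ρ) (hy : y ∈ ball x ρ ∩ ball y ρ)
      (hz : midpoint ℝ x y ∈ ball x ρ ∩ ball y ρ),
      IsMidpointReflection R ⟨x, hx⟩ ⟨y, hy⟩ ⟨midpoint ℝ x y, hz⟩ := by
  have hρ : 0 < ρ := dist_nonneg.trans_lt hxy
  have hx : x ∈ ball x ρ ∩ ball y ρ := ⟨mem_ball_self hρ, hxy⟩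
  have hy : y ∈ ball x ρ ∩ ball y ρ := ⟨mem_ball'.2 hxy, mem_ball_self hρ⟩
  have hz := ((convex_ball x ρ).inter (convex_ball y ρ)).midpoint_mem hx hy
  obtain ⟨R, hR⟩ := (pointReflection_midpoint x y ρ).exists_isometryEquiv
  refine ⟨R, hx, hy, hz, Subtype.ext (by simp [hR]), Subtype.ext (by simp [hR]), fun w ↦ ?_⟩
  rw [Subtype.dist_eq, Subtype.dist_eq, hR, AffineIsometryEquiv.dist_pointReflection_self_real,
    dist_comm]

theorem map_midpoint (hf : IsometryOnto f U V) {x y : E} {ρ : ℝ} (hU : ball x ρ ⊆ U)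
    (hV : ball (f x) ρ ⊆ V) (hxy : dist x y < ρ) :
    f (midpoint ℝ x y) = midpoint ℝ (f x) (f y) := by
  have hx : x ∈ U := hU (mem_ball_self (dist_nonneg.trans_lt hxy))
  have hfxy : dist (f x) (f y) < ρ := by rwa [hf.dist_eq x hx y (hU (mem_ball'.2 hxy))]
  obtain ⟨e, he⟩ := (hf.inter_balls hU hV hxy).exists_isometryEquiv
  obtain ⟨R, hx, hy, hz, hR⟩ := exists_isMidpointReflection hxy
  obtain ⟨S, hx', hy', hz', hS⟩ := exists_isMidpointReflection hfxy
  have hcenter := hR.map_center_eq hS (e := e) (Subtype.ext (he _)) (Subtype.ext (he _))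
  rw [← he ⟨_, hz⟩, hcenter]

end Normed

end IsometryOnto

section LocalLinearity

variable {E F : Type*} [NormedAddCommGroup E] [NormedSpace ℝ E] [NormedAddCommGroup F]
  [NormedSpace ℝ F]

theorem map_half_pow_smul_of_map_midpoint {g : E → F} {δ : ℝ} (hg : g 0 = 0)
    (hmid : ∀ x ∈ ball (0 : E) δ, ∀ y ∈ ball (0 : E) δ,
      g (midpoint ℝ x y) = midpoint ℝ (g x) (g y)) {x : E} (hx : x ∈ ball 0 δ) (n : ℕ) :
    g ((2⁻¹ : ℝ) ^ n • x) = (2⁻¹ : ℝ) ^ n • g x := by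
  have hδ : 0 < δ := pos_of_mem_ball hx
  induction n generalizing x with
  | zero => simp
  | succ n ih =>
    have hhalf : g ((2⁻¹ : ℝ) • x) = (2⁻¹ : ℝ) • g x := by
      have := hmid 0 (mem_ball_self hδ) x hx
      simpa only [midpoint_eq_smul_add, hg, zero_add, invOf_eq_inv] using this
    have hx' : (2⁻¹ : ℝ) • x ∈ ball 0 δ :=
      (convex_ball 0 δ).smul_mem_of_zero_mem (mem_ball_self hδ) hx ⟨by norm_num, by norm_num⟩
    rw [pow_succ, mul_smul, ih hx', hhalf, smul_smul]

theorem eventually_half_pow_smul_mem_ball {δ : ℝ} (hδ : 0 < δ) (x : E) :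
    ∀ᶠ n : ℕ in atTop, (2⁻¹ : ℝ) ^ n • x ∈ ball 0 δ := by
  have hlim : Tendsto (fun n : ℕ ↦ (2⁻¹ : ℝ) ^ n • x) atTop (𝓝 0) := by
    simpa using (tendsto_pow_atTop_nhds_zero_of_lt_one (r := (2⁻¹ : ℝ)) (by norm_num)
      (by norm_num)).smul_const x
  exact hlim (ball_mem_nhds 0 hδ)

theorem exists_extension_half_pow_smul {g : E → F} {δ : ℝ} (hδ : 0 < δ) (hg : g 0 = 0)
    (hmid : ∀ x ∈ ball (0 : E) δ, ∀ y ∈ ball (0 : E) δ,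
      g (midpoint ℝ x y) = midpoint ℝ (g x) (g y)) :
    ∃ L : E → F, ∀ (x : E) (n : ℕ), (2⁻¹ : ℝ) ^ n • x ∈ ball 0 δ →
      g ((2⁻¹ : ℝ) ^ n • x) = (2⁻¹ : ℝ) ^ n • L x := by
  choose N hN using fun x : E ↦ (eventually_half_pow_smul_mem_ball hδ x).exists
  refine ⟨fun x ↦ (2 : ℝ) ^ N x • g ((2⁻¹ : ℝ) ^ N x • x), fun x n hn ↦ ?_⟩
  have hcomm : (2⁻¹ : ℝ) ^ n • g ((2⁻¹ : ℝ) ^ N x • x) =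
      (2⁻¹ : ℝ) ^ N x • g ((2⁻¹ : ℝ) ^ n • x) := by
    rw [← map_half_pow_smul_of_map_midpoint hg hmid (hN x),
      ← map_half_pow_smul_of_map_midpoint hg hmid hn, smul_comm]
  rw [smul_comm, hcomm, smul_smul, ← mul_pow, mul_inv_cancel₀ two_ne_zero, one_pow, one_smul]

theorem exists_eqOn_ball_of_map_midpoint {g : E → F} {δ : ℝ} (hδ : 0 < δ) (hg : g 0 = 0)
    (hcont : ContinuousAt g 0)
    (hmid : ∀ x ∈ ball (0 : E) δ, ∀ y ∈ ball (0 : E) δ,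
      g (midpoint ℝ x y) = midpoint ℝ (g x) (g y)) :
    ∃ L : E →L[ℝ] F, EqOn g L (ball 0 δ) := by
  obtain ⟨L₀, hL₀⟩ := exists_extension_half_pow_smul hδ hg hmid
  have heq : EqOn g L₀ (ball 0 δ) := fun x hx ↦ by simpa using hL₀ x 0 (by simpa using hx)
  have hL₀_mid (x y : E) : L₀ (midpoint ℝ x y) = midpoint ℝ (L₀ x) (L₀ y) := by
    have hsmall := eventually_half_pow_smul_mem_ball hδ (E := E)
    obtain ⟨n, hx, hy, hz⟩ := ((hsmall x).and ((hsmall y).and (hsmall (midpoint ℝ x y)))).exists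
    have key := hmid _ hx _ hy
    simp only [midpoint_eq_smul_add, ← smul_add, smul_comm (⅟2 : ℝ)] at key hz ⊢
    rw [hL₀ _ n hx, hL₀ _ n hy, ← smul_add, smul_comm (⅟2 : ℝ), hL₀ _ n hz] at key
    exact smul_right_injective F (by positivity) key
  let L₁ := AddMonoidHom.ofMapMidpoint ℝ ℝ L₀ (by rw [← heq (mem_ball_self hδ), hg]) hL₀_mid
  have hL₁ : Continuous L₁ := continuous_of_continuousAt_zero L₁
    (hcont.congr (heq.eventuallyEq_of_mem (ball_mem_nhds 0 hδ)))
  exact ⟨L₁.toRealLinearMap hL₁, heq⟩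

theorem norm_map_of_eventually_norm_map {L : E →L[ℝ] F} (hL : ∀ᶠ x in 𝓝 0, ‖L x‖ = ‖x‖) (x : E) :
    ‖L x‖ = ‖x‖ := by
  have hscale := (absorbent_nhds_zero (𝕜 := ℝ) hL).eventually_nhdsNE_zero x
  obtain ⟨t, htx, ht⟩ := (hscale.and eventually_mem_nhdsWithin).exists
  rw [mem_ofPred_eq, map_smul, norm_smul, norm_smul] at htx
  exact mul_left_cancel₀ (norm_ne_zero_iff.2 ht) htx

namespace IsometryOnto

variable {f : E → F} {U : Set E} {V : Set F}

theorem exists_eqOn_ball (hf : IsometryOnto f U V) {a : E} {δ : ℝ} (hδ : 0 < δ)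
    (hU : ball a (3 * δ) ⊆ U) (hV : ball (f a) (3 * δ) ⊆ V) :
    ∃ L : E →L[ℝ] F, ∀ x ∈ ball (0 : E) δ, f (a + x) = f a + L x := by
  have hmem {x : E} (hx : x ∈ ball 0 δ) : a + x ∈ U :=
    hU (by rw [mem_ball_zero_iff] at hx; rw [mem_ball, dist_self_add_left]; linarith)
  have ha : a ∈ U := by simpa using hmem (mem_ball_self hδ)
  have hcont : ContinuousAt (fun x ↦ f (a + x) - f a) 0 := by
    have hUa : U ∈ 𝓝 (a + 0) := by
      rw [add_zero]
      exact mem_of_superset (ball_mem_nhds a (by positivity)) hU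
    exact ((hf.continuousOn.continuousAt hUa).comp (by fun_prop)).sub continuousAt_const
  have hmid (x) (hx : x ∈ ball (0 : E) δ) (y) (hy : y ∈ ball (0 : E) δ) :
      f (a + midpoint ℝ x y) - f a = midpoint ℝ (f (a + x) - f a) (f (a + y) - f a) := by
    have hax := mem_ball_zero_iff.1 hx
    have hay := mem_ball_zero_iff.1 hy
    have hfx : dist (f (a + x)) (f a) < δ := by
      rwa [hf.dist_eq _ (hmem hx) a ha, dist_self_add_left]
    have hxy : dist (a + x) (a + y) < 2 * δ := by
      rw [dist_add_left]
      linarith [dist_le_norm_add_norm x y]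
    have h := hf.map_midpoint (ρ := 2 * δ)
      ((ball_subset_ball' (by rw [dist_self_add_left]; linarith)).trans hU)
      ((ball_subset_ball' (by linarith)).trans hV) hxy
    calc f (a + midpoint ℝ x y) - f a = f (midpoint ℝ (a + x) (a + y)) - f a := by
          congr 2
          simp only [midpoint_eq_smul_add, invOf_eq_inv]
          module
      _ = midpoint ℝ (f (a + x) - f a) (f (a + y) - f a) := by
          rw [h]
          simp only [midpoint_eq_smul_add, invOf_eq_inv]
          module
  obtain ⟨L, hL⟩ := exists_eqOn_ball_of_map_midpoint hδ (by simp) hcont hmid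
  exact ⟨L, fun x hx ↦ by rw [← hL hx, add_sub_cancel]⟩

theorem exists_eventually_eq_add (hf : IsometryOnto f U V)
    (hU : IsOpen U) (hV : IsOpen V) {a : E} (ha : a ∈ U) :
    ∃ L : E ≃ₗᵢ[ℝ] F, ∀ᶠ x in 𝓝 0, f (a + x) = f a + L x := by
  obtain ⟨δ, hδ, hUδ, hVδ⟩ : ∃ δ > 0, ball a (3 * δ) ⊆ U ∧ ball (f a) (3 * δ) ⊆ V := by
    obtain ⟨r, hr, hUr⟩ := Metric.isOpen_iff.1 hU a ha
    obtain ⟨s, hs, hVs⟩ := Metric.isOpen_iff.1 hV (f a) (hf.mapsTo ha)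
    refine ⟨min r s / 3, by positivity, (ball_subset_ball ?_).trans hUr,
      (ball_subset_ball ?_).trans hVs⟩ <;> grind
  obtain ⟨L, hL⟩ := hf.exists_eqOn_ball hδ hUδ hVδ
  have hUa {x : E} (hx : x ∈ ball 0 δ) : a + x ∈ U :=
    hUδ (by rw [mem_ball_zero_iff] at hx; rw [mem_ball, dist_self_add_left]; linarith)
  have hnorm : ∀ᶠ x in 𝓝 0, ‖L x‖ = ‖x‖ := by
    filter_upwards [ball_mem_nhds 0 hδ] with x hx
    calc ‖L x‖ = dist (f (a + x)) (f a) := by rw [hL x hx, dist_self_add_left]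
      _ = ‖x‖ := by rw [hf.dist_eq _ (hUa hx) _ ha, dist_self_add_left]
  have hrange : L.range = ⊤ := by
    have hball : ball 0 δ ⊆ (L.range : Set F) := fun w hw ↦ by
      rw [mem_ball_zero_iff] at hw
      obtain ⟨y, hy, hyw⟩ : f a + w ∈ f '' U := hf.image_eq ▸
        hVδ (by rw [mem_ball, dist_self_add_left]; linarith)
      refine ⟨y - a, ?_⟩
      have hya : y - a ∈ ball 0 δ := by
        rwa [mem_ball_zero_iff, ← dist_eq_norm, ← hf.dist_eq y hy a ha, hyw, dist_self_add_left]
      have := hL _ hya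
      rw [add_sub_cancel, hyw] at this
      exact (add_left_cancel this).symm
    exact ((absorbent_nhds_zero (ball_mem_nhds 0 hδ)).mono hball).submodule_eq_top
  exact ⟨.ofSurjective ⟨L, norm_map_of_eventually_norm_map hnorm⟩ (LinearMap.range_eq_top.1 hrange),
    by filter_upwards [ball_mem_nhds 0 hδ] using hL⟩

theorem exists_eqOn_of_isPreconnected (hf : IsometryOnto f U V) (hU : IsOpen U) (hV : IsOpen V)
    {C : Set E} (hC : IsPreconnected C) (hCU : C ⊆ U) {a : E} (ha : a ∈ C) :
    ∃ L : E ≃ₗᵢ[ℝ] F, ∀ x ∈ C, f x = f a + L (x - a) := by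
  have haffine {b : E} {L : E ≃ₗᵢ[ℝ] F} (hL : ∀ᶠ x in 𝓝 0, f (b + x) = f b + L x) :
      f =ᶠ[𝓝 b] fun x ↦ f b + L (x - b) := by
    have hlim : Tendsto (fun x ↦ x - b) (𝓝 b) (𝓝 0) := by
      simpa using (continuous_sub_right b).tendsto b
    filter_upwards [hlim.eventually hL] with x hx
    rw [← hx, add_sub_cancel]
  have hanalytic_affine (b : E) (L : E ≃ₗᵢ[ℝ] F) (c : E) :
      AnalyticAt ℝ (fun x ↦ f b + L (x - b)) c :=
    analyticAt_const.add (L.toContinuousLinearEquiv.toContinuousLinearMap.analyticAt _ |>.comp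
      (analyticAt_id.sub analyticAt_const))
  have hanalytic : AnalyticOnNhd ℝ f C := fun b hb ↦ by
    obtain ⟨L, hL⟩ := hf.exists_eventually_eq_add hU hV (hCU hb)
    exact (hanalytic_affine b L b).congr (haffine hL).symm
  obtain ⟨L, hL⟩ := hf.exists_eventually_eq_add hU hV (hCU ha)
  exact ⟨L, hanalytic.eqOn_of_preconnected_of_eventuallyEq (fun c _ ↦ hanalytic_affine a L c) hC ha
    (haffine hL)⟩

end IsometryOnto

end LocalLinearity

section OpenUnitGroups

/-- The complex cone generated by the open unit ball around `1`. It is connected and consists of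
units, so it lies in every open group of units. -/
def unitCone (A : Type*) [NormedRing A] [NormedAlgebra ℂ A] : Set A :=
  {a | ∃ z : ℂ, ‖a - z • 1‖ < ‖z‖}

variable {A : Type*} [NormedRing A] {G : Subgroup Aˣ}

theorem isOpen_ofUnits [CompleteSpace A] (hG : IsOpen (G : Set Aˣ)) :
    IsOpen (G.ofUnits : Set A) :=
  Units.isOpenEmbedding_val.isOpenMap _ hG

theorem subset_ofUnits_of_isPreconnected [CompleteSpace A] (hG : IsOpen (G : Set Aˣ)) {s : Set A}
    (hs : IsPreconnected s) (hsu : ∀ x ∈ s, IsUnit x) (h1 : 1 ∈ s) : s ⊆ G.ofUnits := by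
  have hcompl : IsOpen (Units.val '' (G : Set Aˣ)ᶜ) :=
    Units.isOpenEmbedding_val.isOpenMap _ (G.isClosed_of_isOpen hG).isOpen_compl
  refine hs.subset_left_of_subset_union (isOpen_ofUnits hG) hcompl
    ((disjoint_image_iff Units.val_injective).2 disjoint_compl_right) (fun x hx ↦ ?_)
    ⟨1, h1, G.ofUnits.one_mem⟩
  obtain ⟨g, rfl⟩ := hsu x hx
  exact (em (g ∈ G)).imp (fun hg ↦ ⟨g, hg, rfl⟩) (fun hg ↦ ⟨g, hg, rfl⟩)

variable [NormedAlgebra ℂ A]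

theorem smul_one_add_mem_unitCone {z : ℂ} {x : A} (hx : ‖x‖ < ‖z‖) : z • 1 + x ∈ unitCone A :=
  ⟨z, by rwa [add_sub_cancel_left]⟩

theorem smul_one_mem_unitCone {z : ℂ} (hz : z ≠ 0) : z • 1 ∈ unitCone A := by
  simpa using smul_one_add_mem_unitCone (x := (0 : A)) (by simpa using hz)

theorem one_mem_unitCone : 1 ∈ unitCone A := by
  simpa using smul_one_mem_unitCone (A := A) one_ne_zero

theorem unitCone_eq_image :
    unitCone A = (fun p : ℂ × A ↦ p.1 • (1 + p.2)) '' ({0}ᶜ ×ˢ ball 0 1) := by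
  ext a
  constructor
  · rintro ⟨z, hz⟩
    have hz₀ : 0 < ‖z‖ := (norm_nonneg _).trans_lt hz
    have hz₁ : z ≠ 0 := norm_pos_iff.1 hz₀
    refine ⟨(z, z⁻¹ • (a - z • 1)), ⟨hz₁, ?_⟩, ?_⟩
    · rwa [mem_ball_zero_iff, norm_smul, norm_inv, inv_mul_lt_one₀ hz₀]
    · simp [smul_add, smul_inv_smul₀ hz₁]
  · rintro ⟨⟨z, x⟩, ⟨hz, hx⟩, rfl⟩
    refine ⟨z, ?_⟩
    dsimp only
    rw [smul_add, add_sub_cancel_left, norm_smul]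
    exact mul_lt_of_lt_one_right (norm_pos_iff.2 hz) (mem_ball_zero_iff.1 hx)

theorem isPreconnected_unitCone : IsPreconnected (unitCone A) := by
  rw [unitCone_eq_image]
  have hpunctured : IsPreconnected ({0}ᶜ : Set ℂ) :=
    (isConnected_compl_singleton_of_one_lt_rank (by simp) 0).isPreconnected
  exact (hpunctured.prod (convex_ball (0 : A) 1).isPreconnected).image _ (by fun_prop)

theorem isUnit_of_mem_unitCone [CompleteSpace A] {a : A} (ha : a ∈ unitCone A) : IsUnit a := by
  rw [unitCone_eq_image] at ha
  obtain ⟨⟨z, x⟩, ⟨hz, hx⟩, rfl⟩ := ha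
  have hx' : IsUnit (1 + x) := by
    simpa using isUnit_one_sub_of_norm_lt_one (x := -x) (by simpa using hx)
  exact hx'.smul (Units.mk0 z hz)

theorem unitCone_subset_ofUnits [CompleteSpace A] (hG : IsOpen (G : Set Aˣ)) :
    unitCone A ⊆ G.ofUnits :=
  subset_ofUnits_of_isPreconnected hG isPreconnected_unitCone (fun _ ↦ isUnit_of_mem_unitCone)
    one_mem_unitCone

theorem smul_mem_ofUnits [CompleteSpace A] (hG : IsOpen (G : Set Aˣ)) {z : ℂ} (hz : z ≠ 0) {a : A}
    (ha : a ∈ G.ofUnits) : z • a ∈ G.ofUnits := by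
  simpa using mul_mem (unitCone_subset_ofUnits hG (smul_one_mem_unitCone hz)) ha

theorem neg_mem_ofUnits [CompleteSpace A] (hG : IsOpen (G : Set Aˣ)) {a : A}
    (ha : a ∈ G.ofUnits) : -a ∈ G.ofUnits := by
  simpa using smul_mem_ofUnits hG (neg_ne_zero.2 one_ne_zero) ha

theorem exp_mem_ofUnits [CompleteSpace A] (hG : IsOpen (G : Set Aˣ)) (a : A) :
    NormedSpace.exp a ∈ G.ofUnits := by
  let _ : NormedAlgebra ℚ A := NormedAlgebra.restrictScalars ℚ ℂ A
  have hcont : Continuous fun t : ℝ ↦ NormedSpace.exp (t • a) :=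
    NormedSpace.exp_continuous.comp (by fun_prop)
  refine subset_ofUnits_of_isPreconnected hG (isPreconnected_range hcont) ?_ ⟨0, by simp⟩
    ⟨1, by simp⟩
  rintro _ ⟨t, rfl⟩
  exact NormedSpace.isUnit_exp _

theorem one_add_mem_ofUnits_of_character_eq_zero {A : Type*} [NormedCommRing A]
    [NormedAlgebra ℂ A] [CompleteSpace A] {G : Subgroup Aˣ} (hG : IsOpen (G : Set Aˣ)) {a : A}
    (ha : ∀ χ : A →ₐ[ℂ] ℂ, χ a = 0) : 1 + a ∈ G.ofUnits := by
  refine subset_ofUnits_of_isPreconnected hG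
    (isPreconnected_range (f := fun t : ℝ ↦ 1 + t • a) (by fun_prop)) ?_ ⟨0, by simp⟩ ⟨1, by simp⟩
  rintro _ ⟨t, rfl⟩
  by_contra hnot
  obtain ⟨χ, hχ⟩ := WeakDual.CharacterSpace.exists_apply_eq_zero hnot
  have hχa : χ a = 0 := ha (WeakDual.CharacterSpace.equivAlgHom χ)
  have hχt : χ (t • a) = 0 := by
    rw [← Complex.coe_smul, map_smul, hχa, smul_zero]
  simp [hχt] at hχ

end OpenUnitGroups

section Jacobson

namespace JacobsonSemisimple

theorem eq_zero {R : Type*} [Ring R] (hR : JacobsonSemisimple R) {r : R}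
    (hr : ∀ x, IsUnit (1 + x * r)) : r = 0 := by
  suffices r ∈ Ring.jacobson R by rwa [show Ring.jacobson R = ⊥ from hR] at this
  rw [← Ideal.jacobson_bot, Ideal.mem_jacobson_iff]
  intro x
  obtain ⟨s, hs⟩ := (hr x).exists_left_inv
  refine ⟨s, Ideal.mem_bot.2 ?_⟩
  rw [← sub_eq_zero.2 hs]
  noncomm_ring

theorem of_ringEquiv {R S : Type*} [Ring R] [Ring S] (e : R ≃+* S) (hS : JacobsonSemisimple S) :
    JacobsonSemisimple R :=
  Module.jacobson_eq_bot_of_injective (e : R →+* S).toSemilinearMap e.injective hS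

theorem eq_zero_of_add_mem_ofUnits {B : Type*} [NormedRing B] [NormedAlgebra ℂ B] [CompleteSpace B]
    (hB : JacobsonSemisimple B) {H : Subgroup Bˣ} (hH : IsOpen (H : Set Bˣ)) {v : B}
    (hv : ∀ b ∈ H.ofUnits, b + v ∈ H.ofUnits) : v = 0 := by
  have hmul {k b : B} (hk : k ∈ H.ofUnits) (hb : b ∈ H.ofUnits) : b + k * v ∈ H.ofUnits := by
    obtain ⟨g, hg, rfl⟩ := hk
    have := mul_mem (H.mem_ofUnits hg rfl)
      (hv _ (mul_mem (H.mem_ofUnits (H.inv_mem hg) rfl) hb))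
    rwa [mul_add, Units.mul_inv_cancel_left] at this
  refine hB.eq_zero fun x ↦ H.isUnit_of_mem_ofUnits ?_
  obtain ⟨r, hr⟩ := NormedField.exists_lt_norm ℂ ‖x‖
  have hr₀ : -r ≠ 0 := neg_ne_zero.2 (norm_pos_iff.1 ((norm_nonneg x).trans_lt hr))
  have hk := unitCone_subset_ofUnits hH (smul_one_add_mem_unitCone hr)
  have hk' := unitCone_subset_ofUnits hH (smul_one_mem_unitCone (A := B) hr₀)
  have hsum := hmul hk' (hmul hk H.ofUnits.one_mem)
  rwa [add_assoc, ← add_mul, neg_smul, add_neg_cancel_comm] at hsum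

end JacobsonSemisimple

end Jacobson

theorem eq_zero_of_norm_one_add_smul_le {A : Type*} [NormedRing A] [NormedAlgebra ℂ A]
    [NormOneClass A] {d : A} {r : ℝ} (hr : 0 < r) (h : ∀ z : ℂ, ‖z‖ = r → ‖1 + z • d‖ ≤ 1) :
    d = 0 := by
  have hderiv (n : ℕ) : HasDerivAt (fun z : ℂ ↦ (1 + z • d) ^ n) (n • d) 0 := by
    have hbase : HasDerivAt (fun z : ℂ ↦ 1 + z • d) d 0 := by
      simpa using ((hasDerivAt_id (0 : ℂ)).smul_const d).const_add 1
    simpa using hbase.fun_pow' n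
  have hbound (n : ℕ) : n * ‖d‖ ≤ 1 / r := by
    have hdiff : Differentiable ℂ fun z : ℂ ↦ (1 + z • d) ^ n := by fun_prop
    calc n * ‖d‖ = ‖deriv (fun z : ℂ ↦ (1 + z • d) ^ n) 0‖ := by
          rw [(hderiv n).deriv, ← Nat.cast_smul_eq_nsmul ℂ, norm_smul, Complex.norm_natCast]
      _ ≤ 1 / r := Complex.norm_deriv_le_of_forall_mem_sphere_norm_le hr hdiff.diffContOnCl
          fun z hz ↦ (norm_pow_le _ n).trans
            (pow_le_one₀ (norm_nonneg _) (h z (mem_sphere_zero_iff_norm.1 hz)))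
  by_contra hd
  obtain ⟨n, hn⟩ := exists_nat_gt (1 / r / ‖d‖)
  rw [div_lt_iff₀ (norm_pos_iff.2 hd)] at hn
  exact (hbound n).not_gt hn

section GlobalLinearity

variable {A B : Type*} [NormedRing A] [NormedAlgebra ℂ A] [CompleteSpace A] [NormOneClass A]
  [NormedRing B] [NormedAlgebra ℂ B] [CompleteSpace B] {f : A → B} {G : Subgroup Aˣ}
  {H : Subgroup Bˣ}

namespace IsometryOnto

theorem exists_eqOn_ofUnits_add (hf : IsometryOnto f G.ofUnits H.ofUnits)
    (hG : IsOpen (G : Set Aˣ)) (hH : IsOpen (H : Set Bˣ)) :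
    ∃ (L : A ≃ₗᵢ[ℝ] B) (v : B), ∀ a ∈ G.ofUnits, f a = L a + v := by
  have hcone := unitCone_subset_ofUnits hG
  obtain ⟨L, hL⟩ := hf.exists_eqOn_of_isPreconnected (isOpen_ofUnits hG) (isOpen_ofUnits hH)
    isPreconnected_unitCone hcone one_mem_unitCone
  refine ⟨L, f 1 - L 1, fun a ha ↦ ?_⟩
  set c := L.symm (f a - (f 1 - L 1))
  have hc : f a = L c + (f 1 - L 1) := by simp [c]
  -- `f` and the affine map agree on the cone, so `a` and `c` are equidistant from its points
  have hequidistant {p : A} (hp : p ∈ unitCone A) : ‖p - c‖ = ‖p - a‖ := by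
    rw [← L.norm_map (p - c), ← dist_eq_norm p a, ← hf.dist_eq p (hcone hp) a ha, dist_eq_norm,
      hL p hp, hc, map_sub, map_sub]
    congr 1
    abel
  have hac : a - c = 0 := by
    refine eq_zero_of_norm_one_add_smul_le (r := (‖a‖ + 1)⁻¹) (by positivity) fun w hw ↦ ?_
    have hw₀ : w ≠ 0 := norm_pos_iff.1 (hw ▸ by positivity)
    have hwa : ‖a‖ < ‖w⁻¹‖ := by rw [norm_inv, hw, inv_inv]; exact lt_add_one _
    calc ‖1 + w • (a - c)‖ = ‖w‖ * ‖w⁻¹ • 1 + a - c‖ := by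
          rw [← norm_smul, add_sub_assoc, smul_add, smul_inv_smul₀ hw₀]
      _ = ‖w‖ * ‖w⁻¹‖ := by
          rw [hequidistant (smul_one_add_mem_unitCone hwa), add_sub_cancel_right, norm_smul,
            norm_one, mul_one]
      _ ≤ 1 := by rw [norm_inv, mul_inv_cancel₀ (norm_ne_zero_iff.2 hw₀)]
  rw [hc, sub_eq_zero.1 hac]

theorem exists_eqOn_ofUnits (hf : IsometryOnto f G.ofUnits H.ofUnits) (hG : IsOpen (G : Set Aˣ))
    (hH : IsOpen (H : Set Bˣ)) (hB : JacobsonSemisimple B) :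
    ∃ L : A ≃ₗᵢ[ℝ] B, ∀ a ∈ G.ofUnits, f a = L a := by
  obtain ⟨L, v, hL⟩ := hf.exists_eqOn_ofUnits_add hG hH
  have htranslate (b : B) (hb : b ∈ H.ofUnits) : b + (v + v) ∈ H.ofUnits := by
    obtain ⟨a, ha, hab⟩ : -b ∈ f '' G.ofUnits := hf.image_eq ▸ neg_mem_ofUnits hH hb
    have hneg := neg_mem_ofUnits hG ha
    have hfneg : f (-a) = b + (v + v) := by
      rw [hL _ hneg, map_neg, ← sub_eq_iff_eq_add.2 (hL a ha), hab]
      abel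
    exact hfneg ▸ hf.mapsTo hneg
  have hv : v = 0 := by
    have := hB.eq_zero_of_add_mem_ofUnits hH htranslate
    rwa [← two_smul ℝ v, smul_eq_zero_iff_right two_ne_zero] at this
  exact ⟨L, fun a ha ↦ by rw [hL a ha, hv, add_zero]⟩

end IsometryOnto

end GlobalLinearity

section Entire

theorem exists_eq_add_mul_of_norm_le {g : ℂ → ℂ} (hg : Differentiable ℂ g) {a b : ℝ} (hb : 0 ≤ b)
    (h : ∀ z, ‖g z‖ ≤ a + b * ‖z‖) : ∃ c : ℂ, ∀ z, g z = g 0 + c * z := by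
  have ha : 0 ≤ a := by simpa using (norm_nonneg _).trans (h 0)
  have hderiv (w : ℂ) : ‖deriv g w‖ ≤ a + 2 * b := by
    have hr : 0 < ‖w‖ + 1 := by positivity
    calc ‖deriv g w‖ ≤ (a + b * (2 * ‖w‖ + 1)) / (‖w‖ + 1) := by
          refine Complex.norm_deriv_le_of_forall_mem_sphere_norm_le hr hg.diffContOnCl fun z hz ↦
            (h z).trans ?_
          gcongr
          have := norm_le_norm_add_norm_sub' z w
          rw [← dist_eq_norm, mem_sphere.1 hz] at this
          linarith
      _ ≤ a + 2 * b := by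
          rw [div_le_iff₀ hr]
          nlinarith [norm_nonneg w]
  obtain ⟨c, hc⟩ := hg.deriv.exists_const_forall_eq_of_bounded
    (isBounded_iff_forall_norm_le.2 ⟨_, forall_mem_range.2 hderiv⟩)
  have hsub (z : ℂ) : HasDerivAt (fun z ↦ g z - c * z) 0 z := by
    simpa [hc] using (hg z).hasDerivAt.fun_sub ((hasDerivAt_id z).const_mul c)
  refine ⟨c, fun z ↦ sub_eq_iff_eq_add.1 ?_⟩
  simpa using is_const_of_deriv_eq_zero (fun z ↦ (hsub z).differentiableAt)
    (fun z ↦ (hsub z).deriv) z 0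

theorem exists_eq_add_mul_of_re_le {g : ℂ → ℂ} (hg : Differentiable ℂ g) {a b : ℝ} (hb : 0 ≤ b)
    (h : ∀ z, (g z).re ≤ a + b * ‖z‖) : ∃ c : ℂ, ∀ z, g z = g 0 + c * z := by
  refine exists_eq_add_mul_of_norm_le (a := 2 * (|a| + 1 + b) + 3 * ‖g 0‖) (b := 4 * b) hg
    (by positivity) fun z ↦ ?_
  have hz := norm_nonneg z
  have hR : 0 < 2 * ‖z‖ + 1 := by positivity
  have hM : 0 < |a| + 1 + b * (2 * ‖z‖ + 1) := by positivity
  have hmaps : MapsTo g (ball 0 (2 * ‖z‖ + 1)) {w | w.re ≤ |a| + 1 + b * (2 * ‖z‖ + 1)} := by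
    refine fun w hw ↦ (h w).trans ?_
    gcongr
    · exact (le_abs_self a).trans (le_add_of_nonneg_right zero_le_one)
    · exact (mem_ball_zero_iff.1 hw).le
  calc ‖g z‖ ≤ 2 * (|a| + 1 + b * (2 * ‖z‖ + 1)) * (‖z‖ / (2 * ‖z‖ + 1 - ‖z‖))
          + ‖g 0‖ * ((2 * ‖z‖ + 1 + ‖z‖) / (2 * ‖z‖ + 1 - ‖z‖)) := by
        simpa only [mul_div_assoc] using Complex.borelCaratheodory hM hg.differentiableOn hmaps hR
          (mem_ball_zero_iff.2 (by linarith))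
    _ ≤ 2 * (|a| + 1 + b * (2 * ‖z‖ + 1)) * 1 + ‖g 0‖ * 3 := by
        gcongr
        · exact (div_le_one (by linarith)).2 (by linarith)
        · exact (div_le_iff₀ (by linarith)).2 (by linarith)
    _ = 2 * (|a| + 1 + b) + 3 * ‖g 0‖ + 4 * b * ‖z‖ := by ring

theorem exists_exp_eq_of_ne_zero {h : ℂ → ℂ} (hh : Differentiable ℂ h) (hne : ∀ z, h z ≠ 0) :
    ∃ g : ℂ → ℂ, Differentiable ℂ g ∧ ∀ z, h z = Complex.exp (g z) := by
  obtain ⟨g, hg₀, hg⟩ :=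
    (hh.deriv.div hh hne).isExactOn_univ.with_val_at 0 (Complex.log (h 0))
  have hquot (z : ℂ) : HasDerivAt (fun z ↦ h z * Complex.exp (-g z)) 0 z := by
    convert! (hh z).hasDerivAt.mul (hg z (mem_univ z)).neg.cexp using 1
    simp only [Pi.div_apply]
    field_simp [hne z]
    ring
  refine ⟨g, fun z ↦ (hg z (mem_univ z)).differentiableAt, fun z ↦ ?_⟩
  have hconst := is_const_of_deriv_eq_zero (fun z ↦ (hquot z).differentiableAt)
    (fun z ↦ (hquot z).deriv) z 0
  rwa [hg₀, Complex.exp_neg, Complex.exp_neg, Complex.exp_log (hne 0), mul_inv_cancel₀ (hne 0),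
    ← div_eq_mul_inv, div_eq_one_iff_eq (Complex.exp_ne_zero _)] at hconst

theorem exists_eq_mul_exp_of_norm_le {h : ℂ → ℂ} (hh : Differentiable ℂ h) (hne : ∀ z, h z ≠ 0)
    {C k : ℝ} (hk : 0 ≤ k) (hbound : ∀ z, ‖h z‖ ≤ C * Real.exp (k * ‖z‖)) :
    ∃ c : ℂ, ∀ z, h z = h 0 * Complex.exp (c * z) := by
  obtain ⟨g, hg, hexp⟩ := exists_exp_eq_of_ne_zero hh hne
  have hC : 0 < C := by simpa using (norm_pos_iff.2 (hne 0)).trans_le (hbound 0)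
  obtain ⟨c, hc⟩ := exists_eq_add_mul_of_re_le (a := Real.log C) hg hk fun z ↦ by
    rw [← Real.exp_le_exp, Real.exp_add, Real.exp_log hC, ← Complex.norm_exp, ← hexp z]
    exact hbound z
  exact ⟨c, fun z ↦ by rw [hexp, hexp, ← Complex.exp_add, ← hc]⟩

end Entire

section GleasonKahaneZelazko

variable {B : Type*} [NormedRing B] [NormedAlgebra ℂ B]

theorem norm_exp_le_exp_norm_of_normOneClass [NormOneClass B] (x : B) :
    ‖NormedSpace.exp x‖ ≤ Real.exp ‖x‖ := by
  let _ : NormedAlgebra ℚ B := NormedAlgebra.restrictScalars ℚ ℂ B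
  have hsum : HasSum (fun n : ℕ ↦ ‖x‖ ^ n / n.factorial) (Real.exp ‖x‖) := by
    rw [Real.exp_eq_exp_ℝ]
    exact NormedSpace.expSeries_div_hasSum_exp ‖x‖
  rw [NormedSpace.exp_eq_tsum ℂ]
  refine tsum_of_norm_bounded hsum fun n ↦ ?_
  rw [norm_smul, norm_inv, Complex.norm_natCast, div_eq_inv_mul]
  gcongr
  exact norm_pow_le x n

theorem exists_exp_eq_smul_exp [CompleteSpace B] {z : ℂ} (hz : z ≠ 0) (b : B) :
    ∃ c, NormedSpace.exp c = z • NormedSpace.exp b := by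
  let _ : NormedAlgebra ℚ B := NormedAlgebra.restrictScalars ℚ ℂ B
  refine ⟨algebraMap ℂ B (Complex.log z) + b, ?_⟩
  rw [NormedSpace.exp_add_of_commute (Algebra.commutes _ _), ← NormedSpace.algebraMap_exp_comm,
    ← Complex.exp_eq_exp_ℂ, Complex.exp_log hz, Algebra.smul_def]

theorem hasDerivAt_map_mul_exp_smul [CompleteSpace B] (φ : B →L[ℂ] ℂ) (x b : B) (z : ℂ) :
    HasDerivAt (fun z : ℂ ↦ φ (x * NormedSpace.exp (z • b)))
      (φ (x * b * NormedSpace.exp (z • b))) z := by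
  rw [mul_assoc]
  exact φ.hasFDerivAt.comp_hasDerivAt z ((hasDerivAt_exp_smul_const' b z).const_mul x)

theorem hasDerivAt_map_exp_smul [CompleteSpace B] (φ : B →L[ℂ] ℂ) (b : B) (z : ℂ) :
    HasDerivAt (fun z : ℂ ↦ φ (NormedSpace.exp (z • b))) (φ (b * NormedSpace.exp (z • b))) z := by
  simpa only [one_mul] using hasDerivAt_map_mul_exp_smul φ 1 b z

theorem map_mul_self_of_map_exp_ne_zero [NormOneClass B] [CompleteSpace B] {φ : B →L[ℂ] ℂ}
    (h1 : φ 1 = 1) {b : B} (hne : ∀ z : ℂ, φ (NormedSpace.exp (z • b)) ≠ 0) :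
    φ (b * b) = φ b * φ b := by
  obtain ⟨c, hc⟩ : ∃ c : ℂ, ∀ z : ℂ, φ (NormedSpace.exp (z • b)) = Complex.exp (c * z) := by
    have hbound (z : ℂ) : ‖φ (NormedSpace.exp (z • b))‖ ≤ ‖φ‖ * Real.exp (‖b‖ * ‖z‖) := by
      refine φ.le_opNorm_of_le ((norm_exp_le_exp_norm_of_normOneClass _).trans ?_)
      rw [norm_smul, mul_comm]
    simpa [h1] using exists_eq_mul_exp_of_norm_le
      (fun z ↦ (hasDerivAt_map_exp_smul φ b z).differentiableAt) hne (norm_nonneg b) hbound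
  have hexp (z : ℂ) : HasDerivAt (fun z ↦ Complex.exp (c * z)) (c * Complex.exp (c * z)) z := by
    simpa [mul_comm] using ((hasDerivAt_id z).const_mul c).cexp
  have hfirst (z : ℂ) : φ (b * NormedSpace.exp (z • b)) = c * Complex.exp (c * z) := by
    have := hasDerivAt_map_exp_smul φ b z
    simp only [hc] at this
    exact this.unique (hexp z)
  have hsecond : φ (b * b) = c * c := by
    have := hasDerivAt_map_mul_exp_smul φ b b 0
    simp only [hfirst, zero_smul, NormedSpace.exp_zero, mul_one] at this
    simpa using this.unique ((hexp 0).const_mul c)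
  have hb : φ b = c := by simpa using hfirst 0
  rw [hsecond, hb]

theorem map_mul_of_map_mul_self {K R : Type*} [Field K] [NeZero (2 : K)] [Ring R] [Algebra K R]
    {θ : R →ₗ[K] K} (h1 : θ 1 = 1) (h : ∀ x, θ (x * x) = θ x * θ x) (x y : R) :
    θ (x * y) = θ x * θ y := by
  have hjordan (x y : R) : θ (x * y) + θ (y * x) = 2 * (θ x * θ y) := by
    have := h (x + y)
    simp only [mul_add, add_mul, map_add, h] at this
    linear_combination this
  have hker {x : R} (hx : θ x = 0) (y : R) : θ (x * y) = 0 := by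
    have hanti : θ (y * x) = -θ (x * y) := by
      linear_combination hjordan x y + 2 * θ y * hx
    have hsq : 2 * (θ (x * y) * θ (x * y)) = 0 := by
      have := hjordan x (y * x * y)
      rw [show x * (y * x * y) = x * y * (x * y) by noncomm_ring,
        show y * x * y * x = y * x * (y * x) by noncomm_ring, h, h, hanti, hx] at this
      linear_combination this
    simpa [two_ne_zero] using hsq
  have := hker (x := x - θ x • 1) (by simp [h1]) y
  rwa [sub_mul, smul_one_mul, map_sub, map_smul, smul_eq_mul, sub_eq_zero] at this

theorem exists_algHom_of_map_exp_ne_zero [NormOneClass B] [CompleteSpace B] (φ : B →L[ℂ] ℂ)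
    (hne : ∀ b, φ (NormedSpace.exp b) ≠ 0) : ∃ θ : B →ₐ[ℂ] ℂ, ∀ b, φ b = φ 1 * θ b := by
  have hφ : φ 1 ≠ 0 := by simpa using hne 0
  set ψ : B →L[ℂ] ℂ := (φ 1)⁻¹ • φ
  have hψ (b : B) : ψ b = (φ 1)⁻¹ * φ b := rfl
  have hψ1 : ψ 1 = 1 := inv_mul_cancel₀ hφ
  have hsq (b : B) : ψ (b * b) = ψ b * ψ b :=
    map_mul_self_of_map_exp_ne_zero hψ1 fun z ↦ mul_ne_zero (inv_ne_zero hφ) (hne (z • b))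
  refine ⟨AlgHom.ofLinearMap ψ hψ1 (map_mul_of_map_mul_self (θ := (ψ : B →ₗ[ℂ] ℂ)) hψ1 hsq),
    fun b ↦ ?_⟩
  rw [AlgHom.ofLinearMap_apply, ContinuousLinearMap.coe_coe, hψ, mul_inv_cancel_left₀ hφ]

/-- The complex-linear part `b ↦ (f b - I f (I b)) / 2` of a real-linear functional `f`; the
antilinear part of `f` is the conjugate of the linear part of the conjugate of `f`. -/
noncomputable def linearPart (f : B →L[ℝ] ℂ) : B →L[ℂ] ℂ where
  toFun b := (f b - Complex.I * f (Complex.I • b)) / 2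
  map_add' x y := by simp only [smul_add, map_add]; ring
  map_smul' z b := by
    have hf (w : ℂ) (c : B) : f (w • c) = w.re * f c + w.im * f (Complex.I • c) := by
      conv_lhs => rw [← Complex.re_add_im w]
      simp only [add_smul, mul_smul, Complex.coe_smul, map_add, map_smul, Complex.real_smul]
    rw [smul_comm, hf z b, hf z (Complex.I • b), smul_smul, Complex.I_mul_I, neg_one_smul, map_neg,
      RingHom.id_apply, smul_eq_mul]
    conv_rhs => rw [← Complex.re_add_im z]
    linear_combination (z.im * f (Complex.I • b) / 2) * Complex.I_mul_I
  cont := by fun_prop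

theorem exists_eq_add_conj (f : B →L[ℝ] ℂ) :
    ∃ φ ψ : B →L[ℂ] ℂ, ∀ b, f b = φ b + starRingEnd ℂ (ψ b) := by
  refine ⟨linearPart f, linearPart ((Complex.conjCLE : ℂ →L[ℝ] ℂ).comp f), fun b ↦ ?_⟩
  have hconj : starRingEnd ℂ (linearPart ((Complex.conjCLE : ℂ →L[ℝ] ℂ).comp f) b) =
      (f b + Complex.I * f (Complex.I • b)) / 2 := by
    simp [linearPart, map_ofNat (starRingEnd ℂ) 2]
  rw [hconj]
  simp only [linearPart, ContinuousLinearMap.coe_mk', LinearMap.coe_mk, AddHom.coe_mk]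
  ring

theorem norm_ne_of_add_conj_ne_zero {p q : ℂ}
    (h : ∀ z ≠ 0, z * p + starRingEnd ℂ (z * q) ≠ 0) : ‖p‖ ≠ ‖q‖ := by
  intro hpq
  rcases eq_or_ne p 0 with rfl | hp
  · have hq : q = 0 := by rwa [norm_zero, eq_comm, norm_eq_zero] at hpq
    exact h 1 one_ne_zero (by simp [hq])
  obtain ⟨z, hz⟩ := IsAlgClosed.exists_pow_nat_eq (-starRingEnd ℂ q / p) two_pos
  have hnorm : ‖z‖ = 1 := by
    rw [← pow_eq_one_iff_of_nonneg (norm_nonneg z) two_ne_zero, ← norm_pow, hz, norm_div, norm_neg,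
      RCLike.norm_conj, hpq, div_self (hpq ▸ norm_ne_zero_iff.2 hp)]
  have hz₀ : z ≠ 0 := norm_ne_zero_iff.1 (hnorm ▸ one_ne_zero)
  have hconj : z * starRingEnd ℂ z = 1 := by simp [Complex.mul_conj', hnorm]
  rw [eq_div_iff hp] at hz
  refine h z hz₀ (mul_left_cancel₀ hz₀ ?_)
  rw [map_mul]
  linear_combination hz + starRingEnd ℂ q * hconj

variable [CompleteSpace B] {φ ψ : B →L[ℂ] ℂ}

theorem map_one_mul_eq_of_norm_map_exp_lt
    (h : ∀ b, ‖ψ (NormedSpace.exp b)‖ < ‖φ (NormedSpace.exp b)‖) (b : B) :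
    φ 1 * ψ b = ψ 1 * φ b := by
  have hne (z : ℂ) : φ (NormedSpace.exp (z • b)) ≠ 0 :=
    norm_pos_iff.1 ((norm_nonneg _).trans_lt (h _))
  have hdiff (χ : B →L[ℂ] ℂ) : Differentiable ℂ fun z : ℂ ↦ χ (NormedSpace.exp (z • b)) :=
    fun z ↦ (hasDerivAt_map_exp_smul χ b z).differentiableAt
  obtain ⟨k, hk⟩ : ∃ k, ∀ z : ℂ, ψ (NormedSpace.exp (z • b)) = k * φ (NormedSpace.exp (z • b)) := by
    obtain ⟨k, hk⟩ := ((hdiff ψ).div (hdiff φ) hne).exists_const_forall_eq_of_bounded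
      (isBounded_iff_forall_norm_le.2 ⟨1, forall_mem_range.2 fun z ↦ by
        simpa only [Pi.div_apply, norm_div] using div_le_one_of_le₀ (h _).le (norm_nonneg _)⟩)
    exact ⟨k, fun z ↦ (div_eq_iff (hne z)).1 (hk z)⟩
  have hone : ψ 1 = k * φ 1 := by simpa using hk 0
  have hb : ψ b = k * φ b := by
    have := hasDerivAt_map_exp_smul ψ b 0
    simp only [hk] at this
    simpa using this.unique ((hasDerivAt_map_exp_smul φ b 0).const_mul k)
  rw [hone, hb]
  ring

theorem exists_algHom_of_norm_map_exp_lt [NormOneClass B]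
    (h : ∀ b, ‖ψ (NormedSpace.exp b)‖ < ‖φ (NormedSpace.exp b)‖) :
    ∃ θ : B →ₐ[ℂ] ℂ, ∀ b, φ b = φ 1 * θ b ∧ ψ b = ψ 1 * θ b := by
  have hne (b : B) : φ (NormedSpace.exp b) ≠ 0 := norm_pos_iff.1 ((norm_nonneg _).trans_lt (h b))
  obtain ⟨θ, hθ⟩ := exists_algHom_of_map_exp_ne_zero φ hne
  refine ⟨θ, fun b ↦ ⟨hθ b, mul_left_cancel₀ (show φ 1 ≠ 0 by simpa using hne 0) ?_⟩⟩
  rw [map_one_mul_eq_of_norm_map_exp_lt h, hθ b, mul_left_comm]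

theorem norm_map_exp_lt_or_gt
    (h : ∀ b, ‖φ (NormedSpace.exp b)‖ ≠ ‖ψ (NormedSpace.exp b)‖) :
    (∀ b, ‖ψ (NormedSpace.exp b)‖ < ‖φ (NormedSpace.exp b)‖) ∨
      ∀ b, ‖φ (NormedSpace.exp b)‖ < ‖ψ (NormedSpace.exp b)‖ := by
  let _ : NormedAlgebra ℚ B := NormedAlgebra.restrictScalars ℚ ℂ B
  by_contra! hcross
  obtain ⟨⟨b, hb⟩, c, hc⟩ := hcross
  have hcont (χ : B →L[ℂ] ℂ) : Continuous fun b ↦ ‖χ (NormedSpace.exp b)‖ :=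
    (χ.continuous.comp NormedSpace.exp_continuous).norm
  obtain ⟨x, hx⟩ := intermediate_value_univ₂ (hcont φ) (hcont ψ) hb hc
  exact h x hx

theorem exists_algHom_of_realLinear_map_exp_ne_zero [NormOneClass B] (f : B →L[ℝ] ℂ)
    (hf : ∀ b, f (NormedSpace.exp b) ≠ 0) : ∃ θ : B →ₐ[ℂ] ℂ, ∀ b, f b = f (θ b • 1) := by
  obtain ⟨φ, ψ, hφψ⟩ := exists_eq_add_conj f
  have hnorm (b : B) : ‖φ (NormedSpace.exp b)‖ ≠ ‖ψ (NormedSpace.exp b)‖ := by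
    refine norm_ne_of_add_conj_ne_zero fun z hz ↦ ?_
    obtain ⟨c, hc⟩ := exists_exp_eq_smul_exp hz b
    simpa only [hc, hφψ, map_smul, smul_eq_mul] using hf c
  obtain ⟨θ, hθ⟩ : ∃ θ : B →ₐ[ℂ] ℂ, ∀ b, φ b = φ 1 * θ b ∧ ψ b = ψ 1 * θ b := by
    rcases norm_map_exp_lt_or_gt hnorm with hlt | hgt
    · exact exists_algHom_of_norm_map_exp_lt hlt
    · obtain ⟨θ, hθ⟩ := exists_algHom_of_norm_map_exp_lt hgt
      exact ⟨θ, fun b ↦ (hθ b).symm⟩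
  refine ⟨θ, fun b ↦ ?_⟩
  simp only [hφψ, map_smul, smul_eq_mul, mul_comm (θ b), ← (hθ b).1, ← (hθ b).2]

end GleasonKahaneZelazko

section Characters

theorem map_mul_of_linearIsometry {p : ℂ →ₗᵢ[ℝ] ℂ} (h1 : p 1 = 1) (z w : ℂ) :
    p (z * w) = p z * p w := by
  have hp : ∀ z, p.toLinearIsometryEquiv rfl z = p z := fun _ ↦ rfl
  rcases linear_isometry_complex_aux ((hp 1).trans h1) with h | h <;>
    simp only [← hp, h, LinearIsometryEquiv.coe_refl, id_eq, Complex.conjLIE_apply, map_mul]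

variable {B : Type*} [NormedRing B] [NormedAlgebra ℂ B] [CompleteSpace B] [NormOneClass B]

theorem map_mul_of_map_exp_ne_zero_of_norm_le {f : B →L[ℝ] ℂ} (hf : ∀ b, f (NormedSpace.exp b) ≠ 0)
    (h1 : f 1 = 1) (hle : ∀ b, ‖f b‖ ≤ ‖b‖) {v : B} (hv : ∀ b, ‖f (v * b)‖ ≤ ‖b‖)
    (hlift : ∀ z, ∃ b, ‖b‖ ≤ ‖z‖ ∧ f (v * b) = z) (x y : B) : f (x * y) = f x * f y := by
  obtain ⟨θ, hθ⟩ := exists_algHom_of_realLinear_map_exp_ne_zero f hf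
  let p : ℂ →ₗ[ℝ] ℂ := f ∘ₗ (LinearMap.toSpanSingleton ℂ B 1).restrictScalars ℝ
  have hfp (b : B) : f b = p (θ b) := hθ b
  have hp1 : p 1 = 1 := by rw [← map_one θ, ← hfp, h1, map_one]
  have hp_le (z : ℂ) : ‖p z‖ ≤ ‖z‖ := (hle (z • 1)).trans_eq (by rw [norm_smul, norm_one, mul_one])
  have hθv : ‖θ v‖ ≤ 1 := by
    have hsq : f (v * starRingEnd ℂ (θ v) • 1) = (‖θ v‖ ^ 2 : ℝ) := by
      rw [hfp, mul_smul_one, map_smul, smul_eq_mul, Complex.conj_mul',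
        ← Complex.ofReal_pow, ← mul_one (Complex.ofReal _), ← Complex.real_smul, map_smul, hp1]
    have := hv (starRingEnd ℂ (θ v) • 1)
    rw [hsq, norm_smul, norm_one, mul_one, RCLike.norm_conj, Complex.norm_real, norm_pow,
      norm_norm] at this
    nlinarith [norm_nonneg (θ v)]
  have hp_lift (z : ℂ) : ∃ w, ‖w‖ ≤ ‖z‖ ∧ p w = z := by
    obtain ⟨b, hb, hbz⟩ := hlift z
    refine ⟨θ (v * b), ?_, by rw [← hfp, hbz]⟩
    rw [map_mul, norm_mul]
    exact (mul_le_of_le_one_left (norm_nonneg _) hθv).trans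
      ((AlgHom.norm_apply_le_self θ b).trans hb)
  have hp_inj : Function.Injective p :=
    LinearMap.injective_iff_surjective.2 fun z ↦ (hp_lift z).imp fun _ ↦ And.right
  have hp_norm (z : ℂ) : ‖p z‖ = ‖z‖ := by
    obtain ⟨w, hw, hwz⟩ := hp_lift (p z)
    exact (hp_le z).antisymm (hp_inj hwz ▸ hw)
  simp only [hfp, map_mul]
  exact map_mul_of_linearIsometry (p := ⟨p, hp_norm⟩) hp1 _ _

theorem character_map_mul {A : Type*} [NormedRing A] [NormedAlgebra ℂ A] [CompleteSpace A]
    [NormOneClass A] {G : Subgroup Aˣ} {H : Subgroup Bˣ} (hH : IsOpen (H : Set Bˣ)) {L : A ≃ₗᵢ[ℝ] B}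
    (hL : L '' G.ofUnits = H.ofUnits) {u : Bˣ} (hu : L 1 = u) (χ : A →ₐ[ℂ] ℂ) (x y : B) :
    χ (L.symm (u * (x * y))) = χ (L.symm (u * x)) * χ (L.symm (u * y)) := by
  have huH : (u : B) ∈ H.ofUnits := by
    rw [← hu, ← SetLike.mem_coe, ← hL]
    exact mem_image_of_mem L G.ofUnits.one_mem
  have hu_norm : ‖(u : B)‖ = 1 := by rw [← hu, L.norm_map, norm_one]
  have hχ (b : B) : ‖χ (L.symm b)‖ ≤ ‖b‖ :=
    (AlgHom.norm_apply_le_self χ _).trans_eq (L.symm.norm_map b)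
  let f : B →L[ℝ] ℂ := (χ.toContinuousLinearMap.restrictScalars ℝ).comp
    ((L.symm : B →L[ℝ] A).comp (ContinuousLinearMap.mul ℝ B u))
  have hf (b : B) : f b = χ (L.symm (u * b)) := rfl
  have hf_inv (b : B) : f (↑u⁻¹ * b) = χ (L.symm b) := by rw [hf, Units.mul_inv_cancel_left]
  refine map_mul_of_map_exp_ne_zero_of_norm_le (f := f) (v := ↑u⁻¹) (fun b ↦ ?_) ?_ (fun b ↦ ?_)
    (fun b ↦ ?_) (fun z ↦ ⟨L (z • 1), ?_, ?_⟩) x y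
  · obtain ⟨a, ha, hab⟩ : u * NormedSpace.exp b ∈ L '' G.ofUnits :=
      hL ▸ mul_mem huH (exp_mem_ofUnits hH b)
    rw [hf, ← hab, L.symm_apply_apply]
    exact ((G.isUnit_of_mem_ofUnits ha).map χ).ne_zero
  · rw [hf, mul_one, ← hu, L.symm_apply_apply, map_one]
  · exact (hχ _).trans ((norm_mul_le _ _).trans_eq (by rw [hu_norm, one_mul]))
  · exact hf_inv b ▸ hχ b
  · rw [L.norm_map, norm_smul, norm_one, mul_one]
  · rw [hf_inv, L.symm_apply_apply, map_smul, map_one, smul_eq_mul, mul_one]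

theorem exists_algEquiv_of_image_ofUnits {A : Type*} [NormedCommRing A] [NormedAlgebra ℂ A]
    [CompleteSpace A] [NormOneClass A] {G : Subgroup Aˣ} {H : Subgroup Bˣ}
    (hB : JacobsonSemisimple B) (hG : IsOpen (G : Set Aˣ)) (hH : IsOpen (H : Set Bˣ))
    {L : A ≃ₗᵢ[ℝ] B} (hL : L '' G.ofUnits = H.ofUnits) {u : Bˣ} (hu : L 1 = u) :
    ∃ Φ : A ≃ₐ[ℝ] B, ∀ a, L a = u * Φ a := by
  let Φ : A ≃ₗ[ℝ] B := L.toLinearEquiv.trans (DistribMulAction.toLinearEquiv ℝ B u⁻¹)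
  have hΦ (a : A) : L a = u * Φ a := (Units.mul_inv_cancel_left u (L a)).symm
  have hΦ1 : Φ 1 = 1 := by rw [← Units.mul_right_inj u, ← hΦ, hu, mul_one]
  have hsymm (b : B) : Φ.symm b = L.symm (u * b) := by
    rw [L.eq_symm_apply, hΦ, Φ.apply_symm_apply]
  have hmul (χ : A →ₐ[ℂ] ℂ) (x y : B) :
      χ (Φ.symm (x * y)) = χ (Φ.symm x) * χ (Φ.symm y) := by
    simpa only [hsymm] using character_map_mul hH hL hu χ x y
  have hzero {b : B} (hb : ∀ χ : A →ₐ[ℂ] ℂ, χ (Φ.symm b) = 0) : b = 0 := by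
    refine hB.eq_zero fun x ↦ (Units.isUnit_units_mul u _).1 (H.isUnit_of_mem_ofUnits ?_)
    have hmem : 1 + Φ.symm (x * b) ∈ G.ofUnits :=
      one_add_mem_ofUnits_of_character_eq_zero hG fun χ ↦ by rw [hmul, hb, mul_zero]
    rw [← SetLike.mem_coe, ← hL, ← hΦ1, ← Φ.apply_symm_apply (x * b), ← map_add, ← hΦ]
    exact mem_image_of_mem L hmem
  refine ⟨AlgEquiv.ofLinearEquiv Φ hΦ1 fun a b ↦ sub_eq_zero.1 (hzero fun χ ↦ ?_), hΦ⟩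
  simp only [map_sub, hmul, Φ.symm_apply_apply, map_mul, sub_self]

end Characters

theorem isometry_of_eq_mul_algEquiv {A B : Type*} [NormedRing A] [NormedAlgebra ℝ A]
    [NormOneClass A] [NormedRing B] [NormedAlgebra ℝ B] [NormOneClass B] {L : A ≃ₗᵢ[ℝ] B} {u : Bˣ}
    {Φ : A ≃ₐ[ℝ] B}
    (hΦ : ∀ a, L a = u * Φ a) : Isometry Φ := by
  refine AddMonoidHomClass.isometry_of_norm Φ fun a ↦ le_antisymm ?_ ?_
  · have hinv : ‖Φ.symm ↑u⁻¹‖ = 1 := by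
      rw [← L.norm_map, hΦ, Φ.apply_symm_apply, Units.mul_inv, norm_one]
    calc ‖Φ a‖ = ‖Φ.symm ↑u⁻¹ * a‖ := by
          rw [← L.norm_map, hΦ, map_mul, Φ.apply_symm_apply, Units.mul_inv_cancel_left]
      _ ≤ ‖a‖ := (norm_mul_le _ _).trans_eq (by rw [hinv, one_mul])
  · have hu : ‖(u : B)‖ = 1 := by rw [← mul_one (u : B), ← map_one Φ, ← hΦ, L.norm_map, norm_one]
    calc ‖a‖ = ‖u * Φ a‖ := by rw [← hΦ, L.norm_map]
      _ ≤ ‖Φ a‖ := (norm_mul_le _ _).trans_eq (by rw [hu, one_mul])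

theorem exists_isometryOnto_ofUnits {A B : Type*} [NormedRing A] [NormedRing B] {G : Subgroup Aˣ}
    {H : Subgroup Bˣ} {T : G → H} (hsurj : Function.Surjective T)
    (hdist : ∀ a b, dist ((T a : Bˣ) : B) ((T b : Bˣ) : B) = dist ((a : Aˣ) : A) ((b : Aˣ) : A)) :
    ∃ f : A → B, IsometryOnto f G.ofUnits H.ofUnits ∧ ∀ a : G, f (a : Aˣ) = (T a : Bˣ) := by
  have hinj : Function.Injective fun a : G ↦ ((a : Aˣ) : A) :=
    Units.val_injective.comp Subtype.val_injective
  obtain ⟨f, hf⟩ : ∃ f : A → B, ∀ a : G, f (a : Aˣ) = (T a : Bˣ) :=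
    ⟨Function.extend _ (fun a ↦ ((T a : Bˣ) : B)) 0, hinj.extend_apply _ _⟩
  refine ⟨f, ⟨?_, Subset.antisymm ?_ ?_⟩, hf⟩
  · rintro _ ⟨a, ha, rfl⟩ _ ⟨b, hb, rfl⟩
    exact (congrArg₂ dist (hf ⟨a, ha⟩) (hf ⟨b, hb⟩)).trans (hdist ⟨a, ha⟩ ⟨b, hb⟩)
  · rintro _ ⟨_, ⟨a, ha, rfl⟩, rfl⟩
    exact ⟨T ⟨a, ha⟩, (T ⟨a, ha⟩).2, (hf ⟨a, ha⟩).symm⟩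
  · rintro _ ⟨b, hb, rfl⟩
    obtain ⟨a, ha⟩ := hsurj ⟨b, hb⟩
    exact ⟨_, ⟨a, a.2, rfl⟩, (hf a).trans (congrArg (fun g : H ↦ ((g : Bˣ) : B)) ha)⟩

theorem corollary5p2 {A B : Type*}
    [NormedCommRing A] [NormedAlgebra ℂ A] [CompleteSpace A] [NormOneClass A]
    [NormedRing B] [NormedAlgebra ℂ B] [CompleteSpace B] [NormOneClass B]
    (hB : JacobsonSemisimple B)
    (𝔄 : Subgroup Aˣ) (h𝔄 : IsOpen (𝔄 : Set Aˣ))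
    (𝔅 : Subgroup Bˣ) (h𝔅 : IsOpen (𝔅 : Set Bˣ))
    (T : 𝔄 → 𝔅) (hT_surj : Function.Surjective T)
    (hT_isom : ∀ a b : 𝔄, dist ((T a : Bˣ) : B) ((T b : Bˣ) : B) = dist ((a : Aˣ) : A) ((b : Aˣ) : A)) :
    (∃ Φ : A ≃ₐ[ℝ] B, Isometry Φ ∧
      ∀ a : 𝔄, Φ ((a : Aˣ) : A) = (((T 1 : Bˣ)⁻¹ : Bˣ) : B) * ((T a : Bˣ) : B)) ∧
    JacobsonSemisimple A ∧
    (∀ x y : B, x * y = y * x) ∧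
    (∃ Ψ : Aˣ ≃* Bˣ, ∀ a b : Aˣ, dist (Ψ a : B) (Ψ b : B) = dist (a : A) (b : A)) := by
  obtain ⟨f, hf, hfT⟩ := exists_isometryOnto_ofUnits hT_surj hT_isom
  obtain ⟨L, hL⟩ := hf.exists_eqOn_ofUnits h𝔄 h𝔅 hB
  have hLT (a : 𝔄) : L (a : Aˣ) = (T a : Bˣ) := (hL _ ⟨a, a.2, rfl⟩).symm.trans (hfT a)
  obtain ⟨Φ, hΦ⟩ := exists_algEquiv_of_image_ofUnits hB h𝔄 h𝔅
    ((image_congr hL).symm.trans hf.image_eq) (hLT 1)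
  have hiso : Isometry Φ := isometry_of_eq_mul_algEquiv hΦ
  have hcomm (x y : B) : x * y = y * x := by
    simpa only [map_mul, Φ.apply_symm_apply] using congrArg Φ (mul_comm (Φ.symm x) (Φ.symm y))
  refine ⟨⟨Φ, hiso, fun a ↦ ?_⟩, hB.of_ringEquiv Φ.toRingEquiv, hcomm,
    Units.mapEquiv Φ.toMulEquiv, fun a b ↦ hiso.dist_eq a b⟩
  rw [← hLT, hΦ, Units.inv_mul_cancel_left]
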